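/- All graphs are finite, simple and undirected. A connected graph $G$ with chromatic number $k$ is called double-critical $k$-chromatic if, for every edge $uv$ of $G$, the graph $G-u-v$ is $(k-2)$-colourable. For a vertex $x$ of $G$, let $G_x := G[N(x)]$ denote the subgraph of $G$ induced by the set $N(x)$ of neighbours of $x$. Let $K_8^-$ denote the complete graph on $8$ vertices with one edge removed. A graph $H$ is a minor of $G$ if there are non-empty, pairwise disjoint sets $V_h \subseteq V(G)$, $h \in V(H)$, such that $G[V_h]$ is connected for every $h\in V(H)$ and, for any two adjacent vertices $h_1,h_2$ of $H$, some edge of $G$ joins a vertex of $V_{h_1}$ to a vertex of $V_{h_2}$. Suppose $G$ is a double-critical $8$-chromatic graph with minimum degree $10$. If $G$ contains a vertex $x$ of degree $10$ such that no vertex of $G_x$ has degree $9$ in $G_x$, then $G$ contains a $K_8^-$ minor. -/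

import Mathlib

namespace SimpleGraph

universe u v

/-- `G` is a double-critical `k`-chromatic graph: `G` is connected with chromatic number `k`, and
deleting the two ends of any edge leaves a `(k - 2)`-colourable graph. (If `G` has an edge then
`2 ≤ k`, so the subtraction never truncates.) -/
def IsDoubleCritical {V : Type u} (G : SimpleGraph V) (k : ℕ) : Prop :=
  G.Connected ∧ G.chromaticNumber = (k : ℕ∞) ∧
    ∀ u v : V, G.Adj u v → (G.induce ({u, v}ᶜ : Set V)).Colorable (k - 2)

/-- `H` is a minor of `G`: there are non-empty, pairwise disjoint, connected branch sets `B h`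
(one for each vertex `h` of `H`) such that adjacent vertices of `H` have branch sets joined by
at least one edge of `G`. -/
def IsMinor {W : Type v} {V : Type u} (H : SimpleGraph W) (G : SimpleGraph V) : Prop :=
  ∃ B : W → Set V,
    (∀ h, (B h).Nonempty) ∧
    (∀ h₁ h₂, h₁ ≠ h₂ → Disjoint (B h₁) (B h₂)) ∧
    (∀ h, (G.induce (B h)).Connected) ∧
    (∀ h₁ h₂, H.Adj h₁ h₂ → ∃ a ∈ B h₁, ∃ b ∈ B h₂, G.Adj a b)

/-- The neighbourhood graph `G_x = G[N(x)]`. -/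
abbrev neighborhoodGraph {V : Type u} (G : SimpleGraph V) (x : V) :
    SimpleGraph (G.neighborSet x) :=
  G.induce (G.neighborSet x)

/-- `K₈⁻`: the complete graph on eight vertices with one edge removed. -/
def completeEightMinus : SimpleGraph (Fin 8) :=
  (completeGraph (Fin 8)).deleteEdges {s(0, 1)}

end SimpleGraph

/-! Let `H` be the complement of `G_x`, a graph on ten vertices. Every edge `xy` of `G` lies in at
least six triangles: each of the six colours of `G - x - y` occurs on a common neighbour, since
otherwise a recolouring would give `G` seven colours (`exists_common_neighbor`). So degrees in `H`
are at most three. Degree zero is excluded by hypothesis and degree one by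
`exists_second_nonneighbor`, which leaves two and three.

If `H` has a vertex of degree two, an exhaustive search (`search_initial`, `search_sound`) yields a
`K₇⁻` model in the complement of `H` with branch sets of size at most two; the vertex `x` extends it
to a `K₈⁻` model.

If `H` is cubic, some vertex lies outside `N[x]`; let `C` be a component of the graph induced on
such vertices. Its attachments do not form a clique (`exists_not_adj_of_separation`), so contracting
`C` into one of two nonadjacent attachments joins them. This deletes an edge of `H`, creates
vertices of degree two, and the search result applies again. -/

/-!
### A kernel-checked search

Partial information on a graph with vertex set `Fin 10` is stored in two natural numbers, one for
the known edges and one for the known non-edges; bit `10 * i + j` stands for the pair `(i, j)`.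
The definitions use recursors and the primitive operations on `ℕ`, because the kernel
evaluates these quickly.
-/

namespace PairModel

/-- Evaluate `n` to a numeral before passing it on. -/
def withValue {α : Type} (n : ℕ) (f : ℕ → α) : α := Nat.rec (f 0) (fun k _ => f k.succ) n

/-- A conditional that the kernel evaluates quickly. -/
def sel {α : Type} (b : Bool) (x y : α) : α := Bool.rec y x b

def both (a b : Bool) : Bool := Bool.rec false b a

def anyOf {α : Type} (f : α → Bool) (l : List α) : Bool :=
  List.rec false (fun a _ r => sel (f a) true r) l

def allOf {α : Type} (f : α → Bool) (l : List α) : Bool :=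
  List.rec true (fun a _ r => both (f a) r) l

def pairwiseOf {α : Type} (f : α → α → Bool) (l : List α) : Bool :=
  List.rec true (fun a t r => both (allOf (f a) t) r) l

def vertices : List ℕ := [9, 8, 7, 6, 5, 4, 3, 2, 1, 0]

def below (n : ℕ) : List ℕ := Nat.rec [] (fun k r => k :: r) n

def entry (M i j : ℕ) : ℕ := Nat.land 1 (Nat.shiftRight M (Nat.add (Nat.mul 10 i) j))

def line (M i : ℕ) : ℕ := Nat.mod (Nat.shiftRight M (Nat.mul 10 i)) 1024

/-- The number of ones in the binary expansion of `r < 1024`. -/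
def bitCount (r : ℕ) : ℕ := Nat.mod (Nat.land (Nat.mul r 35185445863425) 76861433640456465) 15

def addPair (M i j : ℕ) : ℕ :=
  Nat.lor M (Nat.lor (Nat.shiftLeft 1 (Nat.add (Nat.mul 10 i) j))
    (Nat.shiftLeft 1 (Nat.add (Nat.mul 10 j) i)))

/-- Add the pairs `(i, j)` with `j ∈ l` and `p j`. -/
def addPairs (p : ℕ → Bool) (i : ℕ) (l : List ℕ) (M : ℕ) : ℕ :=
  List.rec M (fun j _ r => sel (p j) (addPair r i j) r) l

/-! A block `(a, b)` stands for the branch set `{a, b}`. -/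

def validBlock (N : ℕ) (X : ℕ × ℕ) : Bool :=
  both (Nat.ble X.1 9) (both (Nat.ble X.2 9) (Nat.ble 1 (entry N X.1 X.2)))

def disjointBlocks (X Y : ℕ × ℕ) : Bool :=
  both (both (!Nat.beq X.1 Y.1) (!Nat.beq X.1 Y.2)) (both (!Nat.beq X.2 Y.1) (!Nat.beq X.2 Y.2))

def joinedBlocks (N : ℕ) (X Y : ℕ × ℕ) : Bool :=
  Nat.ble 1 (Nat.lor (Nat.lor (entry N X.1 Y.1) (entry N X.1 Y.2))
    (Nat.lor (entry N X.2 Y.1) (entry N X.2 Y.2)))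

/-- Seven blocks that form a `K₇⁻` model, the first two being the ends of the missing edge. -/
def checkModel (N : ℕ) (X Y : ℕ × ℕ) (R : List (ℕ × ℕ)) : Bool :=
  both (both (Nat.beq R.length 5) (allOf (validBlock N) (X :: Y :: R)))
    (both (pairwiseOf disjointBlocks (X :: Y :: R))
      (both (pairwiseOf (joinedBlocks N) (X :: R)) (allOf (joinedBlocks N Y) R)))

def eraseVertex (b : ℕ) (T : List ℕ) : List ℕ :=
  List.rec [] (fun a T r => sel (Nat.beq a b) T (a :: r)) T

/-- Comparing first components suffices to identify a block, because the blocks of a model are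
disjoint. -/
def eraseBlock (X : ℕ × ℕ) (L : List (ℕ × ℕ)) : List (ℕ × ℕ) :=
  List.rec [] (fun Y L r => sel (Nat.beq X.1 Y.1) L (Y :: r)) L

def checkInOrder (N : ℕ) (L : List (ℕ × ℕ)) : Bool :=
  List.rec false (fun X T _ => List.rec false (fun Y R _ => checkModel N X Y R) T) L

/-- Apply `k` to the first pair of blocks that are not joined; return `b` if there is none. -/
def firstUnjoined (N : ℕ) (k : ℕ × ℕ → ℕ × ℕ → Bool) (b : Bool) (L : List (ℕ × ℕ)) : Bool :=
  List.rec b (fun X T r => List.rec r (fun Y _ s => sel (joinedBlocks N X Y) s (k X Y)) T) L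

/-- The one pair of blocks that may be unjoined is moved to the front, where `checkModel` expects
the missing edge. -/
def checkBlocks (N : ℕ) (L : List (ℕ × ℕ)) : Bool :=
  firstUnjoined N (fun X Y => checkModel N X Y (eraseBlock Y (eraseBlock X L)))
    (checkInOrder N L) L

def adjLine (N i : ℕ) : ℕ := Nat.sub 1023 (line N i)

/-- When `m` marks the vertices not known to be joined to either end of a new block, this counts the
earlier blocks not known to be joined to it. -/
def commonPairs (m : ℕ) (ps : List (ℕ × ℕ)) : ℕ :=
  List.rec 0 (fun p _ r => Nat.add r
    (Nat.land (Nat.land (Nat.shiftRight m p.1) (Nat.shiftRight m p.2)) 1)) ps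

/-- Look for ways to group `2 * n` vertices `T` into blocks of size two, where `S` is the set of
singletons, `ps` holds the blocks chosen so far and `e` counts the missing edges. -/
def pairUp (k : List (ℕ × ℕ) → Bool) (N S n : ℕ) : List ℕ → ℕ → List (ℕ × ℕ) → Bool :=
  Nat.rec (fun _ _ ps => k ps)
    (fun _ next T e ps => List.rec false (fun a T _ => withValue (adjLine N a) fun ma =>
      anyOf (fun b => both (Nat.ble 1 (entry N a b)) (
        withValue (Nat.land ma (adjLine N b)) fun m =>
        withValue (Nat.add e (Nat.add (bitCount (Nat.land m S)) (commonPairs m ps))) fun e =>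
          both (Nat.ble e 1) (next (eraseVertex b T) e ((a, b) :: ps)))) T) T) n

/-- Whether every graph avoiding the pairs in `N` has a complement with a `K₇⁻` model consisting
of four singletons and three pairs. -/
def findModel (N : ℕ) : Bool :=
  anyOf (fun d => anyOf (fun c => withValue (entry N c d) fun e =>
    anyOf (fun b => withValue (Nat.add e (Nat.add (entry N b c) (entry N b d))) fun e =>
      -- Prune early: at most one of the three pairs among `b`, `c`, `d` may be missing.
      both (Nat.ble 2 e) (anyOf (fun a =>
        withValue (Nat.sub 6
          (Nat.add e (Nat.add (entry N a b) (Nat.add (entry N a c) (entry N a d))))) fun e =>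
        both (Nat.ble e 1)
          (pairUp (fun ps => checkBlocks N ((a, a) :: (b, b) :: (c, c) :: (d, d) :: ps)) N
            (Nat.lor (Nat.lor (Nat.shiftLeft 1 a) (Nat.shiftLeft 1 b))
              (Nat.lor (Nat.shiftLeft 1 c) (Nat.shiftLeft 1 d)))
            3 (eraseVertex a (eraseVertex b (eraseVertex c (eraseVertex d vertices)))) e []))
        (below b))) (below c)) (below d)) vertices

/-- Whether exchanging `f` and `g` leaves the symmetric set `M` of pairs unchanged. -/
def swapInvariant (M f g : ℕ) : Bool :=
  withValue (Nat.lor (Nat.shiftLeft 1 f) (Nat.shiftLeft 1 g)) fun m =>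
    both (Nat.beq (Nat.lor (line M f) m) (Nat.lor (line M g) m))
      (Nat.beq (entry M f f) (entry M g g))

/-- If `v` is adjacent to such a `g`, swapping `f` and `g` makes it adjacent to `f` and preserves
all recorded information. -/
def twin (K N v f g : ℕ) : Bool :=
  both (!Nat.beq g v)
    (sel (Nat.beq g f) true (both (swapInvariant N f g) (swapInvariant K f g)))

/-- If `v` already has three neighbours then all other vertices are non-neighbours. -/
def saturate (K N v : ℕ) : ℕ :=
  sel (Nat.ble 3 (bitCount (line K v)))
    (addPairs (fun j => Nat.beq (entry K v j) 0) v vertices N) N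

def lineSum (N : ℕ) : ℕ := List.rec 0 (fun i _ s => Nat.add s (bitCount (line N i))) vertices

/-- Branch on the first undecided pair `(v, f)`: either `v` is adjacent to none of the twins of
`f`, or, up to symmetry, it is adjacent to `f`. -/
def search (n : ℕ) : ℕ → ℕ → Bool :=
  Nat.rec (fun _ _ => false) (fun _ next K N =>
    -- Nine excluded vertices leave degree at most one, which is impossible.
    sel (anyOf (fun i => Nat.ble 9 (bitCount (line N i))) vertices) true
    (sel (both (Nat.ble 68 (lineSum N)) (findModel N)) true
    -- For `M = K ||| N`, the number `M xor (M + 1)` has its top bit at the lowest zero of `M`, the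
    -- first undecided pair.
    (withValue (Nat.log2 (Nat.xor (Nat.lor K N) (Nat.succ (Nat.lor K N)))) fun k =>
      both (Nat.ble k 99) (withValue (Nat.div k 10) fun v => withValue (Nat.mod k 10) fun f =>
      both (!Nat.beq v f) (both
        (withValue (addPairs (twin K N v f) v vertices N) fun N => next K N)
        (withValue (addPair K v f) fun K =>
          withValue (saturate K (saturate K N v) f) fun N => next K N)))))) n

/-- The edges `01` and `02`. -/
def initialEdges : ℕ := addPair (addPair 0 0 1) 0 2

/-- The diagonal and the pairs `(0, j)` with `3 ≤ j`. -/
def initialNonEdges : ℕ := addPairs (fun _ => true) 0 [3, 4, 5, 6, 7, 8, 9]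
  (List.rec 0 (fun i _ M => addPair M i i) vertices)

/-- Each branching decides at least one of the 45 pairs, so fuel 46 is enough. Running out of fuel
returns `false`, so success never depends on the bound. -/
theorem search_initial :
    withValue initialEdges (fun K => withValue initialNonEdges fun N => search 46 K N) = true := by
  decide +kernel

end PairModel

/-! ### Models in the complement, and the recursors as propositions -/

namespace PairModel

/-- The blocks `p i` form a model of `K₇` minus the edge `01` in the complement of `H`. -/
def IsModel {W : Type*} (H : SimpleGraph W) (p : Fin 7 → W × W) : Prop :=
  -- A block with equal components is a singleton, for which this is irreflexivity.
  (∀ i, ¬H.Adj (p i).1 (p i).2) ∧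
  (∀ i j, i < j → ((p i).1 ≠ (p j).1 ∧ (p i).1 ≠ (p j).2) ∧
    ((p i).2 ≠ (p j).1 ∧ (p i).2 ≠ (p j).2)) ∧
  ∀ i j, i < j → ¬(i = 0 ∧ j = 1) →
    (¬H.Adj (p i).1 (p j).1 ∨ ¬H.Adj (p i).1 (p j).2) ∨
    (¬H.Adj (p i).2 (p j).1 ∨ ¬H.Adj (p i).2 (p j).2)

theorem IsModel.of_comap {W W' : Type*} {H : SimpleGraph W} (σ : W' ↪ W) {p : Fin 7 → W' × W'}
    (h : IsModel (H.comap σ) p) : IsModel H fun i => (σ (p i).1, σ (p i).2) := by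
  obtain ⟨h₁, h₂, h₃⟩ := h
  exact ⟨h₁, fun i j hij => by simpa using h₂ i j hij, h₃⟩

section Recursors

variable {α : Type} {f : α → Bool} {l : List α}

theorem withValue_eq {β : Type} (n : ℕ) (f : ℕ → β) : withValue n f = f n := by
  cases n <;> rfl

theorem both_eq_true {a b : Bool} : both a b = true ↔ a = true ∧ b = true := by
  cases a <;> simp [both]

theorem sel_true {a b : Bool} : sel a true b = true ↔ a = true ∨ b = true := by
  cases a <;> simp [sel]

theorem sel_ind {β : Type} {P : β → Prop} {x y : β} (b : Bool) (hx : b = true → P x)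
    (hy : b = false → P y) : P (sel b x y) := by
  cases b
  · exact hy rfl
  · exact hx rfl

theorem anyOf_eq_true : anyOf f l = true ↔ ∃ a ∈ l, f a = true := by
  induction l with
  | nil => simp [anyOf]
  | cons a l ih =>
    have : anyOf f (a :: l) = sel (f a) true (anyOf f l) := rfl
    rw [this, sel_true, ih]; simp

theorem allOf_eq_true : allOf f l = true ↔ ∀ a ∈ l, f a = true := by
  induction l with
  | nil => simp [allOf]
  | cons a l ih =>
    have : allOf f (a :: l) = both (f a) (allOf f l) := rfl
    rw [this, both_eq_true, ih]; simp

theorem pairwiseOf_eq_true {f : α → α → Bool} :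
    pairwiseOf f l = true ↔ l.Pairwise fun a b => f a b = true := by
  induction l with
  | nil => simp [pairwiseOf]
  | cons a l ih =>
    have : pairwiseOf f (a :: l) = both (allOf (f a) l) (pairwiseOf f l) := rfl
    rw [this, both_eq_true, ih, allOf_eq_true]; simp

end Recursors

theorem mem_vertices {i : ℕ} : i ∈ vertices ↔ i < 10 := by
  simp only [vertices, List.mem_cons, List.not_mem_nil, or_false]; omega

/-! ### Bits -/

/-- The pair `(i, j)` belongs to `M`. -/
def Has (M i j : ℕ) : Prop := M.testBit (10 * i + j) = true

theorem entry_eq (M i j : ℕ) : entry M i j = (M.testBit (10 * i + j)).toNat := by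
  change 1 &&& M >>> (10 * i + j) = _
  rw [Nat.testBit_eq_decide_div_mod_eq, Nat.one_and_eq_mod_two, Nat.shiftRight_eq_div_pow]
  rcases Nat.mod_two_eq_zero_or_one (M / 2 ^ (10 * i + j)) with h | h <;> simp [h]

theorem one_le_entry {M i j : ℕ} : 1 ≤ entry M i j ↔ Has M i j := by
  rw [entry_eq, Has]; cases M.testBit (10 * i + j) <;> simp

theorem entry_eq_zero {M i j : ℕ} : entry M i j = 0 ↔ ¬Has M i j := by
  rw [entry_eq, Has]; cases M.testBit (10 * i + j) <;> simp

theorem entry_eq_entry {M i j i' j' : ℕ} :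
    entry M i j = entry M i' j' ↔ (Has M i j ↔ Has M i' j') := by
  rw [entry_eq, entry_eq, Has, Has]
  cases M.testBit (10 * i + j) <;> cases M.testBit (10 * i' + j') <;> simp

theorem testBit_line {M i j : ℕ} (hj : j < 10) : (line M i).testBit j = true ↔ Has M i j := by
  change ((M >>> (10 * i)) % 2 ^ 10).testBit j = true ↔ _
  rw [Nat.testBit_mod_two_pow, Nat.testBit_shiftRight, Has]; simp [hj]

/-- The multiplier is `1 + 2^15 + 2^30 + 2^45`, and the mask keeps the positions divisible by 4. The
four shifts are distinct modulo 4, so each bit of `r` survives exactly once; as `16 ≡ 1` modulo 15,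
the remainder is the number of bits. -/
theorem bitCount_eq : ∀ r < 1024,
    bitCount r = (Finset.univ.filter fun j : Fin 10 => r.testBit j = true).card := by
  decide +kernel

theorem bitCount_line (M i : ℕ) :
    bitCount (line M i) = {j : Fin 10 | Has M i j}.ncard := by
  classical
  rw [bitCount_eq (line M i) (Nat.mod_lt _ (by norm_num)), ← Set.ncard_coe_finset]
  congr 1
  ext j
  simpa using testBit_line j.2

theorem has_addPair {M i j a b : ℕ} (hi : i < 10) (hj : j < 10) (hb : b < 10) :
    Has (addPair M i j) a b ↔ Has M a b ∨ (a = i ∧ b = j) ∨ (a = j ∧ b = i) := by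
  change (M ||| (1 <<< (10 * i + j) ||| 1 <<< (10 * j + i))).testBit (10 * a + b) = true ↔ _
  simp only [Nat.testBit_or, Nat.one_shiftLeft, Nat.testBit_two_pow, Bool.or_eq_true,
    decide_eq_true_eq, Has]
  constructor
  · rintro (h | h | h)
    · exact .inl h
    · right; left; omega
    · right; right; omega
  · rintro (h | ⟨rfl, rfl⟩ | ⟨rfl, rfl⟩) <;> simp [*]

theorem has_addPairs {p : ℕ → Bool} {i a b : ℕ} {l : List ℕ} {M : ℕ} (hi : i < 10)
    (hl : ∀ j ∈ l, j < 10) (hb : b < 10) :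
    Has (addPairs p i l M) a b ↔
      Has M a b ∨ ∃ j ∈ l, p j = true ∧ ((a = i ∧ b = j) ∨ (a = j ∧ b = i)) := by
  induction l with
  | nil => simp [addPairs]
  | cons j l ih =>
    have hd : addPairs p i (j :: l) M =
        sel (p j) (addPair (addPairs p i l M) i j) (addPairs p i l M) := rfl
    have ih := ih fun j hj => hl j (List.mem_cons_of_mem _ hj)
    rw [hd]
    cases hp : p j
    · simp [sel, ih, hp]
    · simp only [sel, has_addPair hi (hl j List.mem_cons_self) hb, ih, List.mem_cons,
        exists_eq_or_imp, hp, true_and, or_assoc]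
      exact or_congr_right (or_comm.trans or_assoc)

theorem forall_addPairs {p : ℕ → Bool} {i : Fin 10} {l : List ℕ} {M : ℕ}
    {P : Fin 10 → Fin 10 → Prop} (hP : ∀ a b, P a b → P b a) (hl : ∀ j ∈ l, j < 10)
    (hM : ∀ a b : Fin 10, Has M a b → P a b)
    (h : ∀ j : Fin 10, (j : ℕ) ∈ l → p j = true → P i j) (a b : Fin 10)
    (hab : Has (addPairs p i l M) a b) : P a b := by
  rcases (has_addPairs i.2 hl b.2).1 hab with h' | ⟨j, hj, hp, ⟨h₁, h₂⟩ | ⟨h₁, h₂⟩⟩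
  · exact hM a b h'
  · obtain rfl : a = i := Fin.ext h₁
    subst h₂
    exact h b hj hp
  · obtain rfl : b = i := Fin.ext h₂
    subst h₁
    exact hP _ _ (h a hj hp)

def Symm (M : ℕ) : Prop := ∀ a b : Fin 10, Has M a b → Has M b a

theorem Symm.addPair {M : ℕ} (h : Symm M) (i j : Fin 10) : Symm (addPair M i j) := by
  intro a b hab
  rw [has_addPair i.2 j.2 b.2] at hab
  rw [has_addPair i.2 j.2 a.2]
  have := h a b
  tauto

theorem Symm.addPairs {M : ℕ} (h : Symm M) (p : ℕ → Bool) (i : Fin 10) {l : List ℕ}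
    (hl : ∀ j ∈ l, j < 10) : Symm (addPairs p i l M) := by
  intro a b hab
  rw [has_addPairs i.2 hl b.2] at hab
  rw [has_addPairs i.2 hl a.2]
  rcases hab with hab | ⟨j, hj, hp, hab⟩
  · exact .inl (h a b hab)
  · exact .inr ⟨j, hj, hp, by tauto⟩

theorem Symm.saturate {K N : ℕ} (h : Symm N) (i : Fin 10) : Symm (saturate K N i) := by
  rw [PairModel.saturate]
  exact sel_ind _ (fun _ => h.addPairs _ _ fun j => mem_vertices.1) fun _ => h

/-- The lines of `f` and `g` agree once bits `f` and `g` are masked; symmetry covers the columns and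
the pair `(f, g)`, and the second test covers the diagonal. -/
theorem has_swap {M : ℕ} (hM : Symm M) {f g : Fin 10} (h : swapInvariant M f g = true)
    (a b : Fin 10) : Has M (Equiv.swap f g a) (Equiv.swap f g b) ↔ Has M a b := by
  have hS (a b : Fin 10) : Has M a b ↔ Has M b a := ⟨hM a b, hM b a⟩
  rw [swapInvariant, withValue_eq, both_eq_true, Nat.beq_eq, Nat.beq_eq,
    entry_eq_entry] at h
  obtain ⟨h₁, h₂⟩ := h
  have key (c : Fin 10) (hf : c ≠ f) (hg : c ≠ g) : Has M f c ↔ Has M g c := by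
    have := congrArg (fun m => m.testBit c = true) h₁
    change ((line M f ||| (1 <<< (f : ℕ) ||| 1 <<< (g : ℕ))).testBit c = true) =
      ((line M g ||| (1 <<< (f : ℕ) ||| 1 <<< (g : ℕ))).testBit c = true) at this
    have hf' : (f : ℕ) ≠ c := fun h => hf (Fin.ext h.symm)
    have hg' : (g : ℕ) ≠ c := fun h => hg (Fin.ext h.symm)
    simpa [Nat.testBit_or, Nat.one_shiftLeft, Nat.testBit_two_pow, hf', hg', testBit_line c.2]
      using this
  by_cases haf : a = f <;> by_cases hag : a = g <;> by_cases hbf : b = f <;>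
    by_cases hbg : b = g <;> simp_all [Equiv.swap_apply_of_ne_of_ne]

/-! ### Soundness -/

/-- The graph `H` has all pairs of `K` as edges and all pairs of `N` as non-edges. -/
structure Fits (K N : ℕ) (H : SimpleGraph (Fin 10)) : Prop where
  edge : ∀ i j : Fin 10, Has K i j → H.Adj i j
  nonedge : ∀ i j : Fin 10, Has N i j → ¬H.Adj i j

theorem exists_isModel_of_checkModel {N : ℕ} {H : SimpleGraph (Fin 10)}
    (hN : ∀ i j : Fin 10, Has N i j → ¬H.Adj i j) {X Y : ℕ × ℕ} {R : List (ℕ × ℕ)}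
    (h : checkModel N X Y R = true) : ∃ p, IsModel H p := by
  simp only [checkModel, both_eq_true, Nat.beq_eq, allOf_eq_true, pairwiseOf_eq_true] at h
  obtain ⟨⟨hlen, hval⟩, hdis, hjX, hjY⟩ := h
  obtain ⟨hjX, hjR⟩ := List.pairwise_cons.1 hjX
  have hL : (X :: Y :: R).length = 7 := by simp [hlen]
  let q : Fin 7 → ℕ × ℕ := fun i => (X :: Y :: R)[i]
  have hq (i) : q i ∈ X :: Y :: R := List.getElem_mem _
  have hval (i) := hval _ (hq i)
  simp only [validBlock, both_eq_true, Nat.ble_eq, one_le_entry] at hval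
  let p : Fin 7 → Fin 10 × Fin 10 := fun i =>
    (⟨(q i).1, Nat.lt_succ_of_le (hval i).1⟩, ⟨(q i).2, Nat.lt_succ_of_le (hval i).2.1⟩)
  refine ⟨p, fun i => hN _ _ (hval i).2.2, fun i j hij => ?_, fun i j hij h01 => ?_⟩
  · have := List.pairwise_iff_getElem.1 hdis i j (by omega) (by omega) hij
    simp only [disjointBlocks, both_eq_true, Bool.not_eq_true', ← Bool.not_eq_true,
      Nat.beq_eq] at this
    simpa [p, q, Fin.ext_iff] using this
  · have : joinedBlocks N (q i) (q j) = true := by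
      obtain ⟨j, hj⟩ := j
      obtain ⟨i, hi⟩ := i
      simp only [Fin.mk_lt_mk] at hij
      match j, i with
      | 1, 0 => simp at h01
      | j + 2, 0 => exact hjX _ (List.getElem_mem _)
      | j + 2, 1 => exact hjY _ (List.getElem_mem _)
      | j + 2, i + 2 => exact List.pairwise_iff_getElem.1 hjR i j (by omega) (by omega) (by omega)
    rw [joinedBlocks, Nat.ble_eq] at this
    have hor (a b : ℕ) (h : 1 ≤ Nat.lor a b) : 1 ≤ a ∨ 1 ≤ b := by
      by_contra! hab
      obtain ⟨rfl, rfl⟩ : a = 0 ∧ b = 0 := by omega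
      exact absurd h (by decide)
    refine (hor _ _ this).imp (fun h => (hor _ _ h).imp ?_ ?_) (fun h => (hor _ _ h).imp ?_ ?_) <;>
      exact fun h => hN _ _ (one_le_entry.1 h)

theorem of_firstUnjoined {N : ℕ} {k : ℕ × ℕ → ℕ × ℕ → Bool} {b : Bool} {L : List (ℕ × ℕ)}
    (h : firstUnjoined N k b L = true) : b = true ∨ ∃ X Y, k X Y = true := by
  induction L with
  | nil => exact .inl h
  | cons X T ih =>
    have inner (T' : List (ℕ × ℕ)) (h : (List.rec (firstUnjoined N k b T)
        (fun Y _ s => sel (joinedBlocks N X Y) s (k X Y)) T' : Bool) = true) :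
        b = true ∨ ∃ X Y, k X Y = true := by
      induction T' with
      | nil => exact ih h
      | cons Y T' ih' =>
        revert h
        exact sel_ind (P := fun c => c = true → b = true ∨ ∃ X Y, k X Y = true) _ (fun _ => ih')
          fun _ h => .inr ⟨X, Y, h⟩
    exact inner T h

theorem exists_checkModel_of_checkBlocks {N : ℕ} {L : List (ℕ × ℕ)} (h : checkBlocks N L = true) :
    ∃ X Y R, checkModel N X Y R = true := by
  rcases of_firstUnjoined h with h | ⟨X, Y, h⟩
  · match L, h with
    | X :: Y :: R, h => exact ⟨X, Y, R, h⟩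
  · exact ⟨X, Y, _, h⟩

/-- All degrees of `H` are two or three. -/
def DegreesTwoThree (H : SimpleGraph (Fin 10)) : Prop :=
  ∀ i, 2 ≤ (H.neighborSet i).ncard ∧ (H.neighborSet i).ncard ≤ 3

theorem pairUp_eq_true {k : List (ℕ × ℕ) → Bool} {N S n : ℕ} : ∀ {T : List ℕ} {e : ℕ}
    {ps : List (ℕ × ℕ)}, pairUp k N S n T e ps = true → ∃ ps, k ps = true := by
  induction n with
  | zero => exact fun {T e ps} h => ⟨ps, h⟩
  | succ n ih =>
    intro T e ps h
    cases T with
    | nil => exact absurd h Bool.false_ne_true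
    | cons a T =>
      change withValue (adjLine N a) (fun ma => anyOf (fun b => both (Nat.ble 1 (entry N a b)) (
        withValue (Nat.land ma (adjLine N b)) fun m =>
        withValue (Nat.add e (Nat.add (bitCount (Nat.land m S)) (commonPairs m ps))) fun e =>
          both (Nat.ble e 1) (pairUp k N S n (eraseVertex b T) e ((a, b) :: ps)))) T) = true at h
      simp only [withValue_eq, anyOf_eq_true, both_eq_true] at h
      obtain ⟨b, -, -, -, h⟩ := h
      exact ih h

theorem exists_isModel_of_findModel {N : ℕ} {H : SimpleGraph (Fin 10)}
    (hN : ∀ i j : Fin 10, Has N i j → ¬H.Adj i j) (h : findModel N = true) : ∃ p, IsModel H p := by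
  simp only [findModel, withValue_eq, anyOf_eq_true, both_eq_true] at h
  obtain ⟨d, -, c, -, b, -, -, a, -, -, h⟩ := h
  obtain ⟨ps, h⟩ := pairUp_eq_true h
  obtain ⟨X, Y, R, h⟩ := exists_checkModel_of_checkBlocks h
  exact exists_isModel_of_checkModel hN h

theorem Fits.addPairs {K N : ℕ} {H : SimpleGraph (Fin 10)} (h : Fits K N H) {p : ℕ → Bool}
    (v : Fin 10) (hp : ∀ j : Fin 10, p j = true → ¬H.Adj v j) :
    Fits K (addPairs p v vertices N) H :=
  ⟨h.edge, forall_addPairs (fun _ _ h h' => h h'.symm) (fun _ => mem_vertices.1) h.nonedge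
    fun j _ => hp j⟩

theorem Fits.saturate {K N : ℕ} {H : SimpleGraph (Fin 10)} (h : Fits K N H)
    (hH : DegreesTwoThree H) (v : Fin 10) : Fits K (saturate K N v) H := by
  rw [PairModel.saturate]
  refine sel_ind (P := fun N => Fits K N H) _ (fun h3 => h.addPairs v fun j hj hvj => ?_) fun _ => h
  rw [Nat.ble_eq, bitCount_line] at h3
  rw [Nat.beq_eq, entry_eq_zero] at hj
  have hs : {j : Fin 10 | Has K v j} ⊆ H.neighborSet v := fun j hj => h.edge v j hj
  have := Set.eq_of_subset_of_ncard_le hs ((hH v).2.trans h3) (Set.toFinite _)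
  exact hj (this.symm.subset hvj)

theorem DegreesTwoThree.comap {H : SimpleGraph (Fin 10)} (hH : DegreesTwoThree H)
    (σ : Equiv.Perm (Fin 10)) : DegreesTwoThree (H.comap σ) := by
  intro i
  have : (H.comap σ).neighborSet i = σ ⁻¹' H.neighborSet (σ i) := rfl
  rw [this, Set.ncard_preimage_of_injective_subset_range σ.injective (by simp)]
  exact hH (σ i)

/-- Quantifying over `H` inside the induction allows relabelled graphs. The counts that prune
`findModel` need no verification, since `checkModel` tests the final blocks from scratch. -/
theorem search_sound {n : ℕ} : ∀ {K N : ℕ}, Symm K → Symm N → search n K N = true →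
    ∀ {H : SimpleGraph (Fin 10)}, DegreesTwoThree H → Fits K N H → ∃ p, IsModel H p := by
  induction n with
  | zero => exact fun {K N} _ _ h => absurd h Bool.false_ne_true
  | succ n ih =>
    intro K N hK hN h H hH hF
    change sel (anyOf (fun i => Nat.ble 9 (bitCount (line N i))) vertices) true
      (sel (both (Nat.ble 68 (lineSum N)) (findModel N)) true
      (withValue (Nat.log2 (Nat.xor (Nat.lor K N) (Nat.succ (Nat.lor K N)))) fun k =>
        both (Nat.ble k 99) (withValue (Nat.div k 10) fun v => withValue (Nat.mod k 10) fun f =>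
        both (!Nat.beq v f) (both
          (withValue (addPairs (twin K N v f) v vertices N) fun N => search n K N)
          (withValue (addPair K v f) fun K =>
            withValue (saturate K (saturate K N v) f) fun N => search n K N))))) = true at h
    simp only [sel_true, withValue_eq, both_eq_true, anyOf_eq_true] at h
    rcases h with ⟨i, hi, h⟩ | ⟨-, h⟩ | ⟨hk, hvf, h₁, h₂⟩
    · rw [Nat.ble_eq, bitCount_line] at h
      lift i to Fin 10 using mem_vertices.1 hi
      have hs : H.neighborSet i ⊆ {j : Fin 10 | Has N i j}ᶜ := fun j hj hj' => hF.nonedge i j hj' hj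
      have h₁ := Set.ncard_le_ncard hs (Set.toFinite _)
      have h₂ := Set.ncard_add_ncard_compl {j : Fin 10 | Has N i j}
      rw [Nat.card_eq_fintype_card, Fintype.card_fin] at h₂
      have := (hH i).1
      omega
    · exact exists_isModel_of_findModel hF.nonedge h
    · revert hk hvf h₁ h₂
      generalize Nat.log2 (Nat.xor (Nat.lor K N) (Nat.succ (Nat.lor K N))) = k
      intro hk
      rw [Nat.ble_eq] at hk
      have hv' : Nat.div k 10 < 10 := by change k / 10 < 10; omega
      have hf' : Nat.mod k 10 < 10 := Nat.mod_lt _ (by norm_num)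
      generalize Nat.div k 10 = v at *
      generalize Nat.mod k 10 = f at *
      lift v to Fin 10 using hv'
      lift f to Fin 10 using hf'
      intro hvf h₁ h₂
      have hvf : v ≠ f := by
        rintro rfl
        simp at hvf
      -- If `v` is adjacent to a twin `g` of `f`, pass to the graph with `f` and `g` exchanged;
      -- otherwise all twins become non-neighbours at once.
      by_cases hex : ∃ g : Fin 10, twin K N v f g = true ∧ H.Adj v g
      · obtain ⟨g, hg, hvg⟩ := hex
        let σ := Equiv.swap f g
        have hσ : (∀ a b, Has N (σ a) (σ b) ↔ Has N a b) ∧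
            ∀ a b, Has K (σ a) (σ b) ↔ Has K a b := by
          rw [twin, both_eq_true, sel_true, both_eq_true, Nat.beq_eq] at hg
          rcases hg.2 with h | h
          · obtain rfl : g = f := Fin.ext h
            simp [σ]
          · exact ⟨has_swap hN h.1, has_swap hK h.2⟩
        have hσv : σ v = v := Equiv.swap_apply_of_ne_of_ne hvf hvg.ne
        have hσf : σ f = g := Equiv.swap_apply_left f g
        have hF' : Fits (addPair K v f) N (H.comap σ) := by
          refine ⟨fun i j hij => ?_, fun i j hij => hF.nonedge _ _ ((hσ.1 i j).2 hij)⟩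
          have hadj : (H.comap σ).Adj v f := by simpa [hσv, hσf] using hvg
          rcases (has_addPair v.2 f.2 j.2).1 hij with h | ⟨h, h'⟩ | ⟨h, h'⟩
          · exact hF.edge _ _ ((hσ.2 i j).2 h)
          · rwa [Fin.ext h, Fin.ext h']
          · rw [Fin.ext h, Fin.ext h']; exact hadj.symm
        have hH' := hH.comap σ
        obtain ⟨p, hp⟩ := ih (hK.addPair v f) ((hN.saturate v).saturate f) h₂ hH'
          ((hF'.saturate hH' v).saturate hH' f)
        exact ⟨_, IsModel.of_comap σ.toEmbedding hp⟩
      · push Not at hex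
        exact ih hK (hN.addPairs _ v fun _ => mem_vertices.1) h₁ hH (hF.addPairs v hex)

theorem exists_isModel {H : SimpleGraph (Fin 10)} (hH : DegreesTwoThree H)
    (h₁ : H.Adj 0 1) (h₂ : H.Adj 0 2) (h₀ : (H.neighborSet 0).ncard = 2) : ∃ p, IsModel H p := by
  have hs := search_initial
  rw [withValue_eq, withValue_eq] at hs
  have h12 : ({1, 2} : Set (Fin 10)) = H.neighborSet 0 := by
    refine Set.eq_of_subset_of_ncard_le ?_ ?_ (Set.toFinite _)
    · rintro j (rfl | rfl)
      exacts [h₁, h₂]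
    · rw [h₀, Set.ncard_pair (by decide)]
  have bits : ∀ i j : Fin 10, (initialEdges.testBit (10 * i + j) = true ↔
      i = 0 ∧ j ∈ [1, 2] ∨ j = 0 ∧ i ∈ [1, 2]) ∧ (initialNonEdges.testBit (10 * i + j) = true ↔
      i = j ∨ i = 0 ∧ j ∉ [1, 2] ∨ j = 0 ∧ i ∉ [1, 2]) := by
    decide +kernel
  have hK (i j : Fin 10) : Has initialEdges i j ↔ _ := (bits i j).1
  have hN (i j : Fin 10) : Has initialNonEdges i j ↔ _ := (bits i j).2
  have hadj (j : Fin 10) : H.Adj 0 j ↔ j ∈ [1, 2] := by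
    have := (Set.ext_iff.1 h12 j).symm
    simpa using this
  refine search_sound (fun a b => ?_) (fun a b => ?_) hs hH ⟨fun i j => ?_, fun i j => ?_⟩
  · rw [hK, hK]; exact Or.symm
  · rw [hN, hN]; exact Or.imp Eq.symm Or.symm
  · rw [hK]
    rintro (⟨rfl, h⟩ | ⟨rfl, h⟩)
    · exact (hadj j).2 h
    · exact ((hadj i).2 h).symm
  · rw [hN]
    rintro (rfl | ⟨rfl, h⟩ | ⟨rfl, h⟩)
    · exact H.irrefl
    · exact fun h' => h ((hadj j).1 h')
    · exact fun h' => h ((hadj i).1 h'.symm)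

end PairModel

/-! ### Colourings of double-critical graphs -/

namespace SimpleGraph

variable {V : Type*} {G : SimpleGraph V}

theorem exists_proper_of_induce_colorable {n : ℕ} [NeZero n] {s : Set V}
    (h : (G.induce s).Colorable n) :
    ∃ f : V → Fin n, ∀ u ∈ s, ∀ v ∈ s, G.Adj u v → f u ≠ f v := by
  classical
  obtain ⟨C⟩ := h
  refine ⟨fun v => if hv : v ∈ s then C ⟨v, hv⟩ else 0, fun u hu v hv huv => ?_⟩
  simpa [hu, hv] using C.valid (v := ⟨u, hu⟩) (w := ⟨v, hv⟩) huv

namespace IsDoubleCritical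

variable {m : ℕ}

theorem not_colorable (hG : G.IsDoubleCritical (m + 2)) : ¬G.Colorable (m + 1) := by
  intro h
  have := h.chromaticNumber_le
  rw [hG.2.1] at this
  norm_cast at this
  omega

/-- Every colour of a colouring of `G - x - y` occurs on a common neighbour of `x` and `y`. -/
theorem exists_common_neighbor (hG : G.IsDoubleCritical (m + 2)) {x y : V} (hxy : G.Adj x y)
    {f : V → Fin m} (hf : ∀ u ∈ ({x, y}ᶜ : Set V), ∀ v ∈ ({x, y}ᶜ : Set V), G.Adj u v → f u ≠ f v)
    (c : Fin m) : ∃ w, G.Adj x w ∧ G.Adj y w ∧ f w = c := by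
  classical
  by_contra! hc
  -- Give `x` the colour `c`, and give the new colour `none` to `y` and to the `c`-coloured
  -- neighbours of `x`. These share an old colour and, by `hc`, avoid `N(y)`, so `m + 1` colours
  -- suffice.
  let g : V → Option (Fin m) := fun v =>
    if v = x then some c else if v = y then none
    else if f v = c ∧ G.Adj x v then none else some (f v)
  have hx : g x = some c := by simp [g]
  have hy : g y = none := by simp [g, hxy.ne']
  have hgx (v) (hv : G.Adj x v) : g v ≠ some c := by
    by_cases hvy : v = y
    · simp [hvy, hy]
    · by_cases hvc : f v = c <;> simp [g, hv.ne', hvy, hvc, hv]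
  have hgy (v) (hv : G.Adj y v) : g v ≠ none := by
    by_cases hvx : v = x
    · simp [hvx, hx]
    · have : ¬(f v = c ∧ G.Adj x v) := fun h => hc v h.2 hv h.1
      simp [g, hvx, hv.ne', this]
  have hg (u v) (huv : G.Adj u v) : g u ≠ g v := by
    by_cases hux : u = x
    · subst hux; rw [hx]; exact (hgx v huv).symm
    by_cases hvx : v = x
    · subst hvx; rw [hx]; exact hgx u huv.symm
    by_cases huy : u = y
    · subst huy; rw [hy]; exact (hgy v huv).symm
    by_cases hvy : v = y
    · subst hvy; rw [hy]; exact hgy u huv.symm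
    have huv' := hf u (by simp [hux, huy]) v (by simp [hvx, hvy]) huv
    simp only [g, hux, huy, hvx, hvy, if_false]
    split_ifs with h₁ h₂ h₂
    · exact absurd (h₁.1.trans h₂.1.symm) huv'
    · simp
    · simp
    · simpa using huv'
  have := (Coloring.mk g fun {u v} => hg u v).colorable
  rw [Fintype.card_option, Fintype.card_fin] at this
  exact hG.not_colorable this

variable [NeZero m]

theorem exists_proper (hG : G.IsDoubleCritical (m + 2)) {x y : V} (hxy : G.Adj x y) :
    ∃ f : V → Fin m, ∀ u ∈ ({x, y}ᶜ : Set V), ∀ v ∈ ({x, y}ᶜ : Set V), G.Adj u v → f u ≠ f v :=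
  exists_proper_of_induce_colorable (hG.2.2 x y hxy)

/-- Common neighbours realising the `m` different colours are distinct. -/
theorem le_ncard_commonNeighbors [Finite V] (hG : G.IsDoubleCritical (m + 2)) {x y : V}
    (hxy : G.Adj x y) : m ≤ (G.commonNeighbors x y).ncard := by
  obtain ⟨f, hf⟩ := hG.exists_proper hxy
  choose w hx hy hw using hG.exists_common_neighbor hxy hf
  have hinj : Function.Injective fun c => (⟨w c, hx c, hy c⟩ : G.commonNeighbors x y) := by
    intro c d hcd
    rw [← hw c, ← hw d, Subtype.mk.inj hcd]
  simpa using Nat.card_le_card_of_injective _ hinj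

/-- A neighbour of `x` does not have exactly one non-neighbour among the other neighbours. -/
theorem exists_second_nonneighbor (hG : G.IsDoubleCritical (m + 2)) {x y z : V}
    (hxy : G.Adj x y) (hxz : G.Adj x z) (hzy : z ≠ y) (hyz : ¬G.Adj y z) :
    ∃ w, w ≠ z ∧ w ≠ y ∧ G.Adj x w ∧ ¬G.Adj y w := by
  -- Colour `G - x - z`. A common neighbour `w` of `x` and `z` with the colour of `y` is not
  -- adjacent to `y`, and differs from `y` because `z` is adjacent to `w` only.
  obtain ⟨f, hf⟩ := hG.exists_proper hxz
  obtain ⟨w, hxw, hzw, hw⟩ := hG.exists_common_neighbor hxz hf (f y)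
  refine ⟨w, hzw.ne', ?_, hxw, fun hyw => ?_⟩
  · rintro rfl
    exact hyz hzw.symm
  · exact hf y (by simp [hxy.ne', hzy.symm]) w (by simp [hxw.ne', hzw.ne']) hyw hw.symm

/-- Colour `G - x - y` for a neighbour `y` and give `y` a new colour. If `x` has no neighbour,
connectedness leaves no other vertex. -/
theorem exists_proper_compl_singleton (hG : G.IsDoubleCritical (m + 2)) (x : V) :
    ∃ f : V → Fin (m + 1), ∀ u v, u ≠ x → v ≠ x → G.Adj u v → f u ≠ f v := by
  classical
  by_cases hx : ∃ y, G.Adj x y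
  · obtain ⟨y, hxy⟩ := hx
    obtain ⟨f, hf⟩ := hG.exists_proper hxy
    refine ⟨fun v => if v = y then Fin.last m else (f v).castSucc, fun u v hu hv huv => ?_⟩
    by_cases huy : u = y <;> by_cases hvy : v = y
    · exact absurd (huy.trans hvy.symm) huv.ne
    · simp [huy, hvy, (Fin.castSucc_lt_last (f v)).ne']
    · simp [huy, hvy, (Fin.castSucc_lt_last (f u)).ne]
    · simpa [huy, hvy] using hf u (by simp [hu, huy]) v (by simp [hv, hvy]) huv
  · push Not at hx
    refine ⟨fun _ => 0, fun u v hu _ huv => ?_⟩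
    obtain ⟨p⟩ := hG.1.preconnected x u
    cases p with
    | nil => exact absurd rfl hu
    | cons h _ => exact absurd h (hx _)

/-- A double-critical graph has no clique separator. -/
theorem exists_not_adj_of_separation (hG : G.IsDoubleCritical (m + 2)) {C : Set V}
    (hC : C.Nonempty) {x : V} (hx : x ∉ C) (hxC : ∀ c ∈ C, ¬G.Adj x c) :
    ∃ u v, u ∉ C ∧ v ∉ C ∧ u ≠ v ∧ ¬G.Adj u v ∧ (∃ c ∈ C, G.Adj u c) ∧ ∃ c ∈ C, G.Adj v c := by
  classical
  by_contra! hclique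
  obtain ⟨c₀, hc₀⟩ := hC
  obtain ⟨f, hf⟩ := hG.exists_proper_compl_singleton c₀
  obtain ⟨g, hg⟩ := hG.exists_proper_compl_singleton x
  -- If the attachments `S` formed a clique, `f` and `g` would both be injective on `S`. A
  -- permutation of colours makes them agree there; then `g` on `C` and `f` elsewhere colour `G`
  -- with `m + 1` colours.
  let S : Set V := {v | v ∉ C ∧ ∃ c ∈ C, G.Adj v c}
  have hS : ∀ u ∈ S, ∀ v ∈ S, u ≠ v → G.Adj u v := by
    rintro u ⟨hu, c, hc, huc⟩ v ⟨hv, d, hd, hvd⟩ huv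
    by_contra h
    exact hclique u v hu hv huv h ⟨c, hc, huc⟩ d hd hvd
  have hSx : ∀ v ∈ S, v ≠ x := by
    rintro v ⟨-, c, hc, hvc⟩ rfl
    exact hxC c hc hvc
  have hSc : ∀ v ∈ S, v ≠ c₀ := by
    rintro v ⟨hv, -⟩ rfl
    exact hv hc₀
  have hginj : Set.InjOn g S := fun u hu v hv huv => by
    by_contra h
    exact hg u v (hSx u hu) (hSx v hv) (hS u hu v hv h) huv
  have hfinj : Set.InjOn f S := fun u hu v hv huv => by
    by_contra h
    exact hf u v (hSc u hu) (hSc v hv) (hS u hu v hv h) huv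
  obtain ⟨π, hπ⟩ : ∃ π : Equiv.Perm (Fin (m + 1)), ∀ v ∈ S, π (g v) = f v := by
    let e : g '' S ≃ f '' S := (Equiv.Set.imageOfInjOn g S hginj).symm.trans
      (Equiv.Set.imageOfInjOn f S hfinj)
    refine ⟨e.extendSubtype, fun v hv => ?_⟩
    rw [e.extendSubtype_apply_of_mem _ ⟨v, hv, rfl⟩]
    have : (Equiv.Set.imageOfInjOn g S hginj).symm ⟨g v, v, hv, rfl⟩ = ⟨v, hv⟩ := by
      rw [Equiv.symm_apply_eq]; rfl
    change ((Equiv.Set.imageOfInjOn f S hfinj)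
      ((Equiv.Set.imageOfInjOn g S hginj).symm ⟨g v, v, hv, rfl⟩) : Fin (m + 1)) = f v
    rw [this]; rfl
  have hCx : ∀ v ∈ C, v ≠ x := fun v hv h => hx (h ▸ hv)
  have hCc : ∀ v ∉ C, v ≠ c₀ := fun v hv h => hv (h ▸ hc₀)
  have cross (u v) (hu : u ∈ C) (hv : v ∉ C) (huv : G.Adj u v) : π (g u) ≠ f v := by
    have hvS : v ∈ S := ⟨hv, u, hu, huv.symm⟩
    rw [← hπ v hvS]
    exact π.injective.ne (hg u v (hCx u hu) (hSx v hvS) huv)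
  refine hG.not_colorable ⟨Coloring.mk (fun v => if v ∈ C then π (g v) else f v) ?_⟩
  intro u v huv
  by_cases hu : u ∈ C <;> by_cases hv : v ∈ C <;> simp only [hu, hv, if_true, if_false]
  · exact π.injective.ne (hg u v (hCx u hu) (hCx v hv) huv)
  · exact cross u v hu hv huv
  · exact (cross v u hv hu huv.symm).symm
  · exact hf u v (hCc u hu) (hCc v hv) huv

end IsDoubleCritical

/-! ### From models to minors -/

/-- A set of pairs that is a `K₇⁻` model in the complement of `H` yields a `K₈⁻` minor of a graph
with a vertex `x` that has a neighbour in each of the branch sets `D i`. -/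
theorem completeEightMinus_isMinor_of_isModel {H : SimpleGraph (Fin 10)}
    {p : Fin 7 → Fin 10 × Fin 10} (hp : PairModel.IsModel H p) (x : V) {D : Fin 10 → Set V}
    (hconn : ∀ i, (G.induce (D i)).Connected) (hdisj : ∀ i j, i ≠ j → Disjoint (D i) (D j))
    (hx : ∀ i, x ∉ D i) (hxD : ∀ i, ∃ a ∈ D i, G.Adj x a)
    (hadj : ∀ i j, i ≠ j → ¬H.Adj i j → ∃ a ∈ D i, ∃ b ∈ D j, G.Adj a b) :
    completeEightMinus.IsMinor G := by
  obtain ⟨hp₁, hp₂, hp₃⟩ := hp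
  -- Putting `x` last keeps the missing edge at the indices 0 and 1.
  let B : Fin 8 → Set V := Fin.lastCases {x} fun i : Fin 7 => D (p i).1 ∪ D (p i).2
  have hlast : B (Fin.last 7) = {x} := Fin.lastCases_last
  have hcast (i : Fin 7) : B i.castSucc = D (p i).1 ∪ D (p i).2 := Fin.lastCases_castSucc _
  have hBx (i : Fin 7) : x ∉ B i.castSucc := by
    rw [hcast]
    exact fun h => h.elim (hx _) (hx _)
  have hconnB (h) : (G.induce (B h)).Connected := by
    induction h using Fin.lastCases with
    | last => rw [hlast]; exact ⟨Preconnected.of_subsingleton⟩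
    | cast i =>
      rw [hcast]
      by_cases h : (p i).1 = (p i).2
      · rw [h, Set.union_self]; exact hconn _
      · obtain ⟨a, ha, b, hb, hab⟩ := hadj _ _ h (hp₁ i)
        exact connected_induce_union (hconn _).preconnected (hconn _).preconnected ha hb hab
  have hdisjB (i j : Fin 7) (hij : i < j) : Disjoint (B i.castSucc) (B j.castSucc) := by
    rw [hcast, hcast]
    obtain ⟨⟨h₁, h₂⟩, h₃, h₄⟩ := hp₂ i j hij
    simp only [Set.disjoint_union_left, Set.disjoint_union_right]
    exact ⟨⟨hdisj _ _ h₁, hdisj _ _ h₃⟩, hdisj _ _ h₂, hdisj _ _ h₄⟩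
  have hadjx (i : Fin 7) : ∃ b ∈ B i.castSucc, G.Adj x b := by
    obtain ⟨a, ha, hxa⟩ := hxD (p i).1
    exact ⟨a, hcast i ▸ .inl ha, hxa⟩
  have hadjB (i j : Fin 7) (hij : i < j) (h01 : ¬(i = 0 ∧ j = 1)) :
      ∃ a ∈ B i.castSucc, ∃ b ∈ B j.castSucc, G.Adj a b := by
    simp only [hcast]
    obtain ⟨⟨h₁, h₂⟩, h₃, h₄⟩ := hp₂ i j hij
    rcases hp₃ i j hij h01 with (h | h) | (h | h)
    · obtain ⟨a, ha, b, hb, hab⟩ := hadj _ _ h₁ h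
      exact ⟨a, .inl ha, b, .inl hb, hab⟩
    · obtain ⟨a, ha, b, hb, hab⟩ := hadj _ _ h₂ h
      exact ⟨a, .inl ha, b, .inr hb, hab⟩
    · obtain ⟨a, ha, b, hb, hab⟩ := hadj _ _ h₃ h
      exact ⟨a, .inr ha, b, .inl hb, hab⟩
    · obtain ⟨a, ha, b, hb, hab⟩ := hadj _ _ h₄ h
      exact ⟨a, .inr ha, b, .inr hb, hab⟩
  refine ⟨B, fun h => ?_, fun h₁ h₂ hne => ?_, hconnB, fun h₁ h₂ hh => ?_⟩
  · exact Set.nonempty_coe_sort.1 (hconnB h).nonempty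
  · induction h₁ using Fin.lastCases with
    | last =>
      induction h₂ using Fin.lastCases with
      | last => exact absurd rfl hne
      | cast j => rw [hlast, Set.disjoint_singleton_left]; exact hBx j
    | cast i =>
      induction h₂ using Fin.lastCases with
      | last => rw [hlast, Set.disjoint_singleton_right]; exact hBx i
      | cast j =>
        rcases lt_or_gt_of_ne (fun h : i = j => hne (h ▸ rfl)) with h | h
        · exact hdisjB i j h
        · exact (hdisjB j i h).symm
  · rw [completeEightMinus, deleteEdges_adj] at hh
    obtain ⟨hne, h01⟩ := hh
    induction h₁ using Fin.lastCases with
    | last =>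
      induction h₂ using Fin.lastCases with
      | last => exact absurd rfl hne
      | cast j =>
        obtain ⟨b, hb, hxb⟩ := hadjx j
        exact ⟨x, hlast ▸ rfl, b, hb, hxb⟩
    | cast i =>
      induction h₂ using Fin.lastCases with
      | last =>
        obtain ⟨b, hb, hxb⟩ := hadjx i
        exact ⟨b, hb, x, hlast ▸ rfl, hxb.symm⟩
      | cast j =>
        rcases lt_or_gt_of_ne (fun h : i = j => hne (h ▸ rfl)) with h | h
        · refine hadjB i j h ?_
          rintro ⟨rfl, rfl⟩
          exact h01 rfl
        · obtain ⟨a, ha, b, hb, hab⟩ := hadjB j i h (by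
            rintro ⟨rfl, rfl⟩
            exact h01 Sym2.eq_swap)
          exact ⟨b, hb, a, ha, hab.symm⟩

/-- Every nonempty set of vertices contains a nonempty connected set closed under adjacency. -/
theorem exists_connected_subset [Finite V] {W : Set V} (hW : W.Nonempty) :
    ∃ C ⊆ W, (G.induce C).Connected ∧ ∀ c ∈ C, ∀ w ∈ W, G.Adj c w → w ∈ C := by
  obtain ⟨w₀, hw₀⟩ := hW
  -- A maximal connected subset is closed, since adding an adjacent vertex keeps it connected.
  obtain ⟨C, hC⟩ := (Set.toFinite {C : Set V | C ⊆ W ∧ (G.induce C).Connected}).exists_maximal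
    ⟨{w₀}, by simpa using hw₀, ⟨Preconnected.of_subsingleton⟩⟩
  refine ⟨C, hC.prop.1, hC.prop.2, fun c hc w hw hcw => ?_⟩
  refine hC.le_of_ge (y := C ∪ {w}) ⟨?_, ?_⟩ Set.subset_union_left (.inr rfl)
  · exact Set.union_subset hC.prop.1 (by simpa using hw)
  · exact connected_induce_union hC.prop.2.preconnected Preconnected.of_subsingleton hc rfl hcw

end SimpleGraph

/-! ### Reduction to the search: relabelling and edge deletion -/

namespace PairModel

theorem DegreesTwoThree.exists_isModel {H : SimpleGraph (Fin 10)} (hH : DegreesTwoThree H)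
    {i : Fin 10} (hi : (H.neighborSet i).ncard = 2) : ∃ p, IsModel H p := by
  obtain ⟨a, b, hab, hN⟩ := Set.ncard_eq_two.1 hi
  have ha : H.Adj i a := (Set.ext_iff.1 hN a).2 (by simp)
  have hb : H.Adj i b := (Set.ext_iff.1 hN b).2 (by simp)
  obtain ⟨σ, hσ⟩ : ∃ σ : Equiv.Perm (Fin 10), σ 0 = i ∧ σ 1 = a ∧ σ 2 = b := by
    obtain ⟨g, hg⟩ := Finset.exists_equiv_extend_of_card_eq (α := Fin 10) (t := Finset.univ)
      (by simp) (s := {0, 1, 2}) (f := fun j => if j = 0 then i else if j = 1 then a else b)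
      (Finset.subset_univ _) (by
        have h₁ := ha.ne
        have h₂ := hb.ne
        have h₁' := ha.ne'
        have h₂' := hb.ne'
        have h₃ := hab.symm
        intro x hx y hy hxy
        simp only [Finset.coe_insert, Finset.coe_singleton, Set.mem_insert_iff,
          Set.mem_singleton_iff] at hx hy
        rcases hx with rfl | rfl | rfl <;> rcases hy with rfl | rfl | rfl <;> simp_all)
    refine ⟨g.trans (Equiv.subtypeUnivEquiv Finset.mem_univ), ?_, ?_, ?_⟩
    · simpa using hg 0 (by simp)
    · simpa using hg 1 (by simp)
    · simpa using hg 2 (by simp)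
  obtain ⟨rfl, rfl, rfl⟩ := hσ
  obtain ⟨p, hp⟩ := PairModel.exists_isModel (hH.comap σ) ha hb (by
    have : (H.comap σ).neighborSet 0 = σ ⁻¹' H.neighborSet (σ 0) := rfl
    rw [this, Set.ncard_preimage_of_injective_subset_range σ.injective (by simp), hi])
  exact ⟨_, IsModel.of_comap σ.toEmbedding hp⟩

/-- Deleting an edge of a cubic graph. -/
theorem exists_isModel_deleteEdges {H : SimpleGraph (Fin 10)}
    (hH : ∀ i, (H.neighborSet i).ncard = 3) {u v : Fin 10} (huv : H.Adj u v) :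
    ∃ p, IsModel (H.deleteEdges {s(u, v)}) p := by
  have hne := huv.ne
  have hu : (H.deleteEdges {s(u, v)}).neighborSet u = H.neighborSet u \ {v} := by
    ext j
    simp only [SimpleGraph.mem_neighborSet, SimpleGraph.deleteEdges_adj, Set.mem_singleton_iff,
      Sym2.eq_iff, Set.mem_sdiff]
    tauto
  have hv : (H.deleteEdges {s(u, v)}).neighborSet v = H.neighborSet v \ {u} := by
    ext j
    simp only [SimpleGraph.mem_neighborSet, SimpleGraph.deleteEdges_adj, Set.mem_singleton_iff,
      Sym2.eq_iff, Set.mem_sdiff]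
    tauto
  have hother (i) (hiu : i ≠ u) (hiv : i ≠ v) :
      (H.deleteEdges {s(u, v)}).neighborSet i = H.neighborSet i := by
    ext j
    simp [hiu, hiv]
  have hu2 : ((H.deleteEdges {s(u, v)}).neighborSet u).ncard = 2 := by
    rw [hu, Set.ncard_sdiff_singleton_of_mem (by exact huv), hH]
  have hv2 : ((H.deleteEdges {s(u, v)}).neighborSet v).ncard = 2 := by
    rw [hv, Set.ncard_sdiff_singleton_of_mem (by exact huv.symm), hH]
  refine DegreesTwoThree.exists_isModel (fun i => ?_) hu2
  by_cases hiu : i = u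
  · rw [hiu, hu2]; omega
  by_cases hiv : i = v
  · rw [hiv, hv2]; omega
  · rw [hother i hiu hiv, hH]; omega

end PairModel

/-! ### The degree-two and cubic cases -/

open SimpleGraph in
theorem mainTheorem5 {V : Type*} [Fintype V] (G : SimpleGraph V)
    [DecidableRel G.Adj] (hG : G.IsDoubleCritical 8) (hδ : G.minDegree = 10)
    (x : V) (hx : G.degree x = 10)
    (hGx : ∀ y : G.neighborSet x, (G.neighborhoodGraph x).degree y ≠ 9) :
    SimpleGraph.completeEightMinus.IsMinor G := by
  classical
  replace hG : G.IsDoubleCritical (6 + 2) := hG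
  have e : Fin 10 ≃ G.neighborSet x :=
    (Fintype.equivFinOfCardEq ((G.card_neighborSet_eq_degree x).trans hx)).symm
  have hxe (i) : G.Adj x (e i) := (e i).2
  have einj {i j} (h : (e i : V) = e j) : i = j := e.injective (Subtype.ext h)
  have esurj (w) (hw : G.Adj x w) : ∃ j, (e j : V) = w := ⟨e.symm ⟨w, hw⟩, by simp⟩
  let A : Fin 10 → Set (Fin 10) := fun i => {j | G.Adj (e i) (e j)}
  let H : SimpleGraph (Fin 10) := (G.comap fun i => (e i : V))ᶜ
  have hHadj (i j) : H.Adj i j ↔ i ≠ j ∧ ¬G.Adj (e i) (e j) := by simp [H, compl_adj]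
  have hAcard (i) : (A i).ncard = (G.commonNeighbors x (e i)).ncard := by
    have : G.commonNeighbors x (e i) = (fun j => (e j : V)) '' A i := by
      ext w
      constructor
      · rintro ⟨h₁, h₂⟩
        obtain ⟨j, rfl⟩ := esurj w h₁
        exact ⟨j, h₂, rfl⟩
      · rintro ⟨j, hj, rfl⟩
        exact ⟨hxe j, hj⟩
    rw [this, Set.ncard_image_of_injective _ fun i j => einj]
  have hA6 (i) : 6 ≤ (A i).ncard := hAcard i ▸ hG.le_ncard_commonNeighbors (hxe i)
  have hA9 (i) : (A i).ncard ≠ 9 := by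
    have hd := hGx (e i)
    rw [← card_neighborSet_eq_degree, ← Nat.card_eq_fintype_card, Nat.card_coe_set_eq] at hd
    have : (G.neighborhoodGraph x).neighborSet (e i) = e '' A i := by
      ext w
      constructor
      · intro h
        exact ⟨e.symm w, by simpa [A] using h, by simp⟩
      · rintro ⟨j, hj, rfl⟩
        exact hj
    rwa [this, Set.ncard_image_of_injective _ e.injective] at hd
  have hsum (i) : (H.neighborSet i).ncard + (A i).ncard = 9 := by
    have h₁ : H.neighborSet i = (insert i (A i))ᶜ := by
      ext j
      simp [hHadj, A, eq_comm]
    have h₂ := Set.ncard_add_ncard_compl (insert i (A i))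
    rw [Set.ncard_insert_of_notMem (by simp [A]), Nat.card_eq_fintype_card, Fintype.card_fin,
      ← h₁] at h₂
    omega
  have hH1 (i) : (H.neighborSet i).ncard ≠ 1 := by
    intro h
    obtain ⟨j, hj⟩ := Set.ncard_eq_one.1 h
    have hij : H.Adj i j := (Set.ext_iff.1 hj j).2 rfl
    rw [hHadj] at hij
    obtain ⟨w, hwj, hwi, hxw, hw⟩ := hG.exists_second_nonneighbor (hxe i) (hxe j)
      (fun h => hij.1 (einj h).symm) hij.2
    obtain ⟨l, rfl⟩ := esurj w hxw
    have : H.Adj i l := (hHadj i l).2 ⟨fun h => hwi (h ▸ rfl), hw⟩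
    exact hwj (congrArg (fun j => (e j : V)) ((Set.ext_iff.1 hj l).1 this))
  have hdeg : PairModel.DegreesTwoThree H := fun i => by
    have := hsum i
    have := hA6 i
    have := hA9 i
    have := hH1 i
    omega
  by_cases h2 : ∃ i, (H.neighborSet i).ncard = 2
  · obtain ⟨i, hi⟩ := h2
    obtain ⟨p, hp⟩ := hdeg.exists_isModel hi
    refine completeEightMinus_isMinor_of_isModel hp x (D := fun i => {(e i : V)})
      (fun i => ⟨Preconnected.of_subsingleton⟩) (fun i j hij => ?_) (fun i => ?_)
      (fun i => ⟨e i, rfl, hxe i⟩) fun i j hij hHij => ?_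
    · exact Set.disjoint_singleton.2 fun h => hij (einj h)
    · exact (hxe i).ne
    · refine ⟨_, rfl, _, rfl, ?_⟩
      by_contra h
      exact hHij ((hHadj i j).2 ⟨hij, h⟩)
  · have h3 (i) : (H.neighborSet i).ncard = 3 := by
      have := hdeg i
      have := not_exists.1 h2 i
      omega
    -- Otherwise `e 0` has at most `1 + 6` neighbours, against minimum degree 10.
    have hW : ({w | w ≠ x ∧ ¬G.Adj x w} : Set V).Nonempty := by
      by_contra! hW
      have hsub : G.neighborSet (e 0) ⊆ insert x (G.commonNeighbors x (e 0)) := fun w hw => by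
        by_contra h
        have : w ∈ ({w | w ≠ x ∧ ¬G.Adj x w} : Set V) :=
          ⟨fun h' => h (.inl h'), fun h' => h (.inr ⟨h', hw⟩)⟩
        rw [hW] at this
        exact this
      have h₁ := (Set.ncard_le_ncard hsub).trans (Set.ncard_insert_le _ _)
      have h₂ := G.minDegree_le_degree (e 0)
      rw [← card_neighborSet_eq_degree, ← Nat.card_eq_fintype_card, Nat.card_coe_set_eq, hδ] at h₂
      have := hsum 0
      have := hAcard 0
      have := h3 0
      omega
    obtain ⟨C, hCW, hCconn, hCclosed⟩ := exists_connected_subset (G := G) hW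
    have hxC : x ∉ C := fun h => (hCW h).1 rfl
    have heC (i) : (e i : V) ∉ C := fun h => (hCW h).2 (hxe i)
    obtain ⟨u, v, hu, hv, huv, hnadj, ⟨c, hc, huc⟩, d, hd, hvd⟩ :=
      hG.exists_not_adj_of_separation (Set.nonempty_coe_sort.1 hCconn.nonempty) hxC
        fun c hc => (hCW hc).2
    -- Since `C` is closed among the vertices outside `N[x]`, its attachments lie in `N(x)`.
    have hxN {u} (hu : u ∉ C) {c} (hc : c ∈ C) (huc : G.Adj u c) : G.Adj x u := by
      by_contra h
      refine hu (hCclosed c hc u ⟨?_, h⟩ huc.symm)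
      rintro rfl
      exact (hCW hc).2 huc
    obtain ⟨i, rfl⟩ := esurj u (hxN hu hc huc)
    obtain ⟨j, rfl⟩ := esurj v (hxN hv hd hvd)
    have hij : i ≠ j := fun h => huv (h ▸ rfl)
    obtain ⟨p, hp⟩ := PairModel.exists_isModel_deleteEdges h3 ((hHadj i j).2 ⟨hij, hnadj⟩)
    -- Absorbing `C` into the branch set of `i` joins it to that of `j` through `d`, which accounts
    -- for the deleted edge of `H`.
    let D : Fin 10 → Set V := fun l => if l = i then C ∪ {(e i : V)} else {(e l : V)}
    have hDi : D i = C ∪ {(e i : V)} := if_pos rfl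
    have hDne {l} (hl : l ≠ i) : D l = {(e l : V)} := if_neg hl
    have heD (l) : (e l : V) ∈ D l := by
      by_cases hl : l = i
      · rw [hl, hDi]; exact .inr rfl
      · rw [hDne hl]; rfl
    have hdisj (l) (hl : l ≠ i) : Disjoint (D i) (D l) := by
      rw [hDi, hDne hl, Set.disjoint_singleton_right]
      rintro (h | h)
      · exact heC l h
      · exact hl (einj h)
    refine completeEightMinus_isMinor_of_isModel hp x (D := D) (fun l => ?_) (fun l k hlk => ?_)
      (fun l => ?_) (fun l => ⟨e l, heD l, hxe l⟩) fun l k hlk hHlk => ?_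
    · by_cases hl : l = i
      · rw [hl, hDi]
        exact connected_induce_union hCconn.preconnected Preconnected.of_subsingleton hc rfl huc.symm
      · rw [hDne hl]; exact ⟨Preconnected.of_subsingleton⟩
    · by_cases hl : l = i
      · subst hl; exact hdisj k hlk.symm
      by_cases hk : k = i
      · subst hk; exact (hdisj l hl).symm
      rw [hDne hl, hDne hk]
      exact Set.disjoint_singleton.2 fun h => hlk (einj h)
    · by_cases hl : l = i
      · rw [hl, hDi]
        rintro (h | h)
        · exact hxC h
        · exact (hxe i).ne h
      · rw [hDne hl]; exact (hxe l).ne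
    · by_cases hadj : G.Adj (e l) (e k)
      · exact ⟨_, heD l, _, heD k, hadj⟩
      · rw [deleteEdges_adj, hHadj] at hHlk
        have hs : s(l, k) = s(i, j) := by
          by_contra h
          exact hHlk ⟨⟨hlk, hadj⟩, h⟩
        rcases Sym2.eq_iff.1 hs with ⟨rfl, rfl⟩ | ⟨rfl, rfl⟩
        · exact ⟨d, hDi ▸ .inl hd, _, heD _, hvd.symm⟩
        · exact ⟨_, heD _, d, hDi ▸ .inl hd, hvd⟩
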